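/- For a permutation $\pi \in S_n$ let $t(\pi)$ denote the length of the shortest string of transpositions whose product is $\pi$. For an irreducible complex representation $\lambda$ of $S_n$ with character $\chi_\lambda$ and dimension $d_\lambda$, say that $\lambda$ is \emph{big} if $d_\lambda > e^{-\sqrt{n}\log n}\sqrt{n!}$, where $\log$ is the natural logarithm. Then for every real $A > \sqrt{2}\,e^2$ there is an integer $N$ such that for all $n \ge N$, all big irreducible representations $\lambda$ of $S_n$, and all $\pi \in S_n$ with $t(\pi) > \sqrt{n}\log n$, \[ \left|\frac{\chi_\lambda(\pi)}{d_\lambda}\right| \le A^{t(\pi)}\, n^{-t(\pi)/2}. \] -/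

import Mathlib

/-- `transpositionLength π` is the length of the shortest string of transpositions
whose product is `π`. -/
noncomputable def transpositionLength {n : ℕ} (π : Equiv.Perm (Fin n)) : ℕ :=
  sInf {k : ℕ | ∃ l : List (Equiv.Perm (Fin n)),
    l.length = k ∧ (∀ τ ∈ l, τ.IsSwap) ∧ l.prod = π}

/-- The minimum in `transpositionLength` is attained. -/
theorem transpositionLength_spec {n : ℕ} (π : Equiv.Perm (Fin n)) :
    ∃ l : List (Equiv.Perm (Fin n)),
      l.length = transpositionLength π ∧ (∀ τ ∈ l, τ.IsSwap) ∧ l.prod = π := by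
  have h : {k : ℕ | ∃ l : List (Equiv.Perm (Fin n)),
      l.length = k ∧ (∀ τ ∈ l, τ.IsSwap) ∧ l.prod = π}.Nonempty :=
    ⟨_, (Equiv.Perm.swapFactors π).1, rfl, (Equiv.Perm.swapFactors π).2.2,
      (Equiv.Perm.swapFactors π).2.1⟩
  exact Nat.sInf_mem h

/-- A complex representation `V` of `S_n` is big if its dimension is more than
`e ^ (-√n log n) √(n!)`. -/
def IsBig {n : ℕ} {V : Type*} [AddCommGroup V] [Module ℂ V]
    (_ρ : Representation ℂ (Equiv.Perm (Fin n)) V) : Prop :=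
  Real.exp (-(√(n : ℝ) * Real.log n)) * √(n.factorial : ℝ) < (Module.finrank ℂ V : ℝ)

/-! Since `∑ σ, |χ(σ)|² = n!`, the class of `π` has at most `n! / |χ(π)|²` elements. On the other
hand, if `π` has `c` nontrivial cycles on `s` moved points, then the formula for the order of its
centralizer gives a class of at least `(n / e²) ^ (s - c)` elements; as `π` is a product of `s - c`
transpositions, this is enough for a class of at least `(n / e²) ^ t(π)` elements. Hence
`|χ(π)| ≤ (e / √n) ^ t(π) √(n!)`, and for a big representation with `t(π) ≥ √n log n` the remaining
factor `√(n!) / d` is at most `e ^ t(π)`. -/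

open scoped ComplexConjugate

section Trace

open Module Module.End

variable {K V : Type*} [Field K] [AddCommGroup V] [Module K V]

theorem apply_eq_inv_smul_of_mem_eigenspace {f g : End K V} (hgf : g * f = 1) {μ : K} {x : V}
    (hx : x ∈ f.eigenspace μ) : g x = μ⁻¹ • x := by
  have hgx : μ • g x = x := by
    rw [← map_smul, ← mem_eigenspace_iff.mp hx, ← Module.End.mul_apply, hgf, one_apply]
  rcases eq_or_ne μ 0 with rfl | hμ
  · rw [← hgx, zero_smul, map_zero, smul_zero]
  · exact (eq_inv_smul_iff₀ hμ).mpr hgx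

theorem pow_eq_one_of_hasEigenvalue {f : End K V} {m : ℕ} (hf : f ^ m = 1) {μ : K}
    (hμ : f.HasEigenvalue μ) : μ ^ m = 1 := by
  obtain ⟨x, hx⟩ := hμ.exists_hasEigenvector
  have h : (1 : K) • x = μ ^ m • x := by rw [← hx.pow_apply, hf, one_smul, one_apply]
  exact (smul_left_injective K hx.2 h).symm

theorem isSemisimple_of_pow_eq_one {f : End K V} {m : ℕ} (hm : (m : K) ≠ 0) (hf : f ^ m = 1) :
    f.IsSemisimple :=
  isSemisimple_of_squarefree_aeval_eq_zero
    (Polynomial.separable_X_pow_sub_C (1 : K) hm one_ne_zero).squarefree (by simp [hf])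

theorem trace_eq_sum_mul_finrank [FiniteDimensional K V] {ι : Type*} [DecidableEq ι]
    {N : ι → Submodule K V} (hN : DirectSum.IsInternal N) (hfin : {i | N i ≠ ⊥}.Finite)
    {g : End K V} {c : ι → K} (hg : ∀ i, ∀ x ∈ N i, g x = c i • x) :
    LinearMap.trace K V g = ∑ i ∈ hfin.toFinset, c i * finrank K (N i) := by
  have hmaps : ∀ i, Set.MapsTo g (N i) (N i) := fun i x hx => by
    rw [SetLike.mem_coe, hg i x hx]
    exact Submodule.smul_mem _ _ hx
  rw [LinearMap.trace_eq_sum_trace_restrict' hN hfin hmaps]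
  refine Finset.sum_congr rfl fun i _ => ?_
  have hrestrict : g.restrict (hmaps i) = c i • LinearMap.id := by
    ext x
    exact hg i x x.2
  rw [hrestrict, map_smul, LinearMap.trace_id, smul_eq_mul]

theorem trace_eq_conj_trace_of_mul_eq_one {V : Type*} [AddCommGroup V] [Module ℂ V]
    [FiniteDimensional ℂ V] {f g : End ℂ V} {m : ℕ} (hm : m ≠ 0) (hf : f ^ m = 1)
    (hgf : g * f = 1) : LinearMap.trace ℂ V g = conj (LinearMap.trace ℂ V f) := by
  classical
  have hss : f.IsSemisimple := isSemisimple_of_pow_eq_one (Nat.cast_ne_zero.mpr hm) hf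
  have hint : DirectSum.IsInternal f.eigenspace :=
    DirectSum.isInternal_submodule_of_iSupIndep_of_iSup_eq_top f.eigenspaces_iSupIndep
      hss.iSup_eigenspace_eq_top
  have hfin : {μ | f.eigenspace μ ≠ ⊥}.Finite :=
    WellFoundedGT.finite_ne_bot_of_iSupIndep f.eigenspaces_iSupIndep
  rw [trace_eq_sum_mul_finrank hint hfin fun μ x => mem_eigenspace_iff.mp,
    trace_eq_sum_mul_finrank hint hfin fun μ x => apply_eq_inv_smul_of_mem_eigenspace hgf, map_sum]
  refine Finset.sum_congr rfl fun μ hμ => ?_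
  have hroot : μ ^ m = 1 := pow_eq_one_of_hasEigenvalue hf (hfin.mem_toFinset.mp hμ)
  rw [map_mul, Complex.conj_natCast,
    Complex.inv_eq_conj (Complex.norm_eq_one_of_pow_eq_one hroot hm)]

end Trace

section Character

variable {G V : Type*} [Group G] [AddCommGroup V] [Module ℂ V] [FiniteDimensional ℂ V]

theorem character_inv_eq_conj [Finite G] (ρ : Representation ℂ G V) (g : G) :
    ρ.character g⁻¹ = conj (ρ.character g) :=
  trace_eq_conj_trace_of_mul_eq_one Nat.card_pos.ne'
    (by rw [← map_pow, pow_card_eq_one', map_one]) (by rw [← map_mul, inv_mul_cancel, map_one])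

variable {ρ : Representation ℂ G V}

theorem sum_sq_norm_character [Fintype G] (hρ : ρ.IsIrreducible) :
    ∑ g : G, ‖ρ.character g‖ ^ 2 = Nat.card G := by
  have hcard : (Nat.card G : ℂ) ≠ 0 := Nat.cast_ne_zero.mpr Nat.card_pos.ne'
  have : Invertible (Nat.card G : ℂ) := invertibleOfNonzero hcard
  have horth : ∑ g : G, ρ.character g * ρ.character g⁻¹ = Nat.card G := by
    have h := Representation.char_orthonormal ρ ρ
    rwa [if_pos ⟨Representation.Equiv.refl ρ⟩, inv_mul_eq_iff_eq_mul₀ hcard, mul_one] at h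
  simp only [character_inv_eq_conj, Complex.mul_conj'] at horth
  exact_mod_cast horth

theorem card_isConj_mul_sq_norm_character_le [Finite G] (hρ : ρ.IsIrreducible) (g : G) :
    (Nat.card {h : G | IsConj g h} : ℝ) * ‖ρ.character g‖ ^ 2 ≤ Nat.card G := by
  classical
  have := Fintype.ofFinite G
  have hconst : ∀ h ∈ ({h | IsConj g h} : Finset G),
      ‖ρ.character h‖ ^ 2 = ‖ρ.character g‖ ^ 2 := by
    intro h hh
    obtain ⟨c, rfl⟩ := isConj_iff.mp (Finset.mem_filter.mp hh).2
    rw [ρ.char_conj]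
  calc (Nat.card {h : G | IsConj g h} : ℝ) * ‖ρ.character g‖ ^ 2
      = ∑ h with IsConj g h, ‖ρ.character h‖ ^ 2 := by
        rw [Finset.sum_congr rfl hconst, Finset.sum_const, nsmul_eq_mul, Set.coe_ofPred,
          Nat.card_eq_fintype_card, Fintype.card_subtype]
    _ ≤ ∑ h, ‖ρ.character h‖ ^ 2 :=
        Finset.sum_le_univ_sum_of_nonneg fun _ => by positivity
    _ = Nat.card G := sum_sq_norm_character hρ

end Character

section ConjugacyClass

open Equiv Equiv.Perm
open scoped Nat

theorem pow_mul_factorial_le_descFactorial_mul_pow {n s : ℕ} (h : s ≤ n) :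
    n ^ s * s ! ≤ n.descFactorial s * s ^ s := by
  calc n ^ s * s ! = ∏ i ∈ Finset.range s, n * (s - i) := by
        rw [← Nat.descFactorial_self, Nat.descFactorial_eq_prod_range, Finset.prod_mul_distrib,
          Finset.prod_const, Finset.card_range]
    _ ≤ ∏ i ∈ Finset.range s, (n - i) * s := by
        refine Finset.prod_le_prod' fun i _ => ?_
        rw [Nat.mul_sub, Nat.sub_mul, mul_comm n i]
        exact Nat.sub_le_sub_left (Nat.mul_le_mul_left i h) _
    _ = n.descFactorial s * s ^ s := by
        rw [Nat.descFactorial_eq_prod_range, Finset.prod_mul_distrib, Finset.prod_const,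
          Finset.card_range]

theorem pow_le_descFactorial_mul_exp {n s : ℕ} (h : s ≤ n) :
    (n : ℝ) ^ s ≤ n.descFactorial s * Real.exp s := by
  have hpow : (n : ℝ) ^ s * s ! ≤ n.descFactorial s * (s : ℝ) ^ s :=
    mod_cast pow_mul_factorial_le_descFactorial_mul_pow h
  calc (n : ℝ) ^ s ≤ n.descFactorial s * (s : ℝ) ^ s / s ! := by
        rwa [le_div_iff₀ (by positivity)]
    _ = n.descFactorial s * ((s : ℝ) ^ s / s !) := mul_div_assoc ..
    _ ≤ n.descFactorial s * Real.exp s := by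
        gcongr
        exact Real.pow_div_factorial_le_exp _ s.cast_nonneg s

theorem prod_mul_prod_factorial_count_le_pow_card {m : Multiset ℕ} {n : ℕ} (h : m.sum ≤ n) :
    m.prod * ∏ i ∈ m.toFinset, (m.count i)! ≤ n ^ m.card := by
  rw [Finset.prod_multiset_count, ← Finset.prod_mul_distrib, ← Multiset.toFinset_sum_count_eq,
    ← Finset.prod_pow_eq_pow_sum]
  refine Finset.prod_le_prod' fun i hi => ?_
  have hin : i * m.count i ≤ n := by
    refine le_trans ?_ h
    rw [Finset.sum_multiset_count, mul_comm]
    exact Finset.single_le_sum (f := fun i => m.count i • i) (fun _ _ => Nat.zero_le _) hi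
  calc i ^ m.count i * (m.count i)! ≤ i ^ m.count i * m.count i ^ m.count i := by
        gcongr
        exact Nat.factorial_le_pow _
    _ = (i * m.count i) ^ m.count i := (mul_pow ..).symm
    _ ≤ n ^ m.count i := by gcongr

variable {α : Type*} [DecidableEq α]

theorem exists_isSwap_prod_eq_formPerm :
    ∀ l : List α, l.Nodup → ∃ w : List (Perm α),
      w.length = l.length - 1 ∧ (∀ τ ∈ w, τ.IsSwap) ∧ w.prod = l.formPerm
  | [], _ => ⟨[], by simp⟩
  | [_], _ => ⟨[], by simp⟩
  | x :: y :: l, h => by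
    obtain ⟨w, hlen, hswap, hprod⟩ := exists_isSwap_prod_eq_formPerm (y :: l) h.of_cons
    refine ⟨swap x y :: w, by simp [hlen], ?_, by simp [hprod]⟩
    have hxy : x ≠ y := fun hxy => by simp [hxy] at h
    exact List.forall_mem_cons.mpr ⟨⟨x, y, hxy, rfl⟩, hswap⟩

variable [Fintype α]

theorem exists_isSwap_prod_eq (σ : Perm α) :
    ∃ w : List (Perm α), w.length + σ.cycleType.card = σ.cycleType.sum ∧
      (∀ τ ∈ w, τ.IsSwap) ∧ w.prod = σ := by
  induction σ using cycle_induction_on with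
  | base_one => exact ⟨[], by simp⟩
  | base_cycles σ hσ =>
    obtain ⟨x, hx, -⟩ := id hσ
    obtain ⟨w, hlen, hswap, hprod⟩ := exists_isSwap_prod_eq_formPerm _ (nodup_toList σ x)
    rw [length_toList, hσ.cycleOf_eq hx] at hlen
    rw [formPerm_toList, hσ.cycleOf_eq hx] at hprod
    refine ⟨w, ?_, hswap, hprod⟩
    rw [hσ.cycleType, Multiset.card_singleton, Multiset.sum_singleton, hlen,
      Nat.sub_add_cancel hσ.nonempty_support.card_pos]
  | induction_disjoint σ τ hd _ hσ hτ =>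
    obtain ⟨v, hvlen, hvswap, hvprod⟩ := hσ
    obtain ⟨w, hwlen, hwswap, hwprod⟩ := hτ
    refine ⟨v ++ w, ?_, List.forall_mem_append.mpr ⟨hvswap, hwswap⟩, ?_⟩
    · rw [List.length_append, hd.cycleType_mul, Multiset.sum_add, Multiset.card_add]
      omega
    · rw [List.prod_append, hvprod, hwprod]

theorem two_mul_card_cycleType_le_sum (σ : Perm α) :
    2 * σ.cycleType.card ≤ σ.cycleType.sum := by
  simpa [mul_comm] using
    Multiset.card_nsmul_le_sum (s := σ.cycleType) fun _ => two_le_of_mem_cycleType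

theorem descFactorial_sum_cycleType_le (σ : Perm α) :
    (Fintype.card α).descFactorial σ.cycleType.sum ≤
      Nat.card {τ : Perm α | IsConj σ τ} * Fintype.card α ^ σ.cycleType.card := by
  set n := Fintype.card α
  set s := σ.cycleType.sum
  set z := ∏ i ∈ σ.cycleType.toFinset, (σ.cycleType.count i)!
  have hs : s ≤ n := σ.sum_cycleType_le
  have hclass : n.descFactorial s =
      Nat.card {τ : Perm α | IsConj σ τ} * (σ.cycleType.prod * z) := by
    apply Nat.eq_of_mul_eq_mul_left (n - s).factorial_pos
    rw [Nat.factorial_mul_descFactorial hs, ← card_isConj_mul_eq σ]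
    ring
  rw [hclass]
  exact Nat.mul_le_mul_left _ (prod_mul_prod_factorial_count_le_pow_card hs)

theorem div_exp_two_pow_le_card_isConj (σ : Perm α) {u : ℕ}
    (hu : u + σ.cycleType.card = σ.cycleType.sum) :
    (Fintype.card α / Real.exp 2) ^ u ≤ Nat.card {τ : Perm α | IsConj σ τ} := by
  have htwo := two_mul_card_cycleType_le_sum σ
  have hsum := σ.sum_cycleType_le
  have hdesc : ((Fintype.card α).descFactorial σ.cycleType.sum : ℝ) ≤
      Nat.card {τ : Perm α | IsConj σ τ} * (Fintype.card α : ℝ) ^ σ.cycleType.card :=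
    mod_cast descFactorial_sum_cycleType_le σ
  have hexp : Real.exp σ.cycleType.sum ≤ Real.exp 2 ^ u := by
    rw [← Real.exp_nat_mul, Real.exp_le_exp]
    exact_mod_cast (by omega : σ.cycleType.sum ≤ u * 2)
  have hpos : (0 : ℝ) < (Fintype.card α : ℝ) ^ σ.cycleType.card := by
    exact_mod_cast Nat.pow_pos_iff.mpr (by omega)
  rw [div_pow, div_le_iff₀ (by positivity)]
  refine le_of_mul_le_mul_right ?_ hpos
  calc (Fintype.card α : ℝ) ^ u * (Fintype.card α : ℝ) ^ σ.cycleType.card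
      = (Fintype.card α : ℝ) ^ σ.cycleType.sum := by rw [← pow_add, hu]
    _ ≤ (Fintype.card α).descFactorial σ.cycleType.sum * Real.exp σ.cycleType.sum :=
        pow_le_descFactorial_mul_exp hsum
    _ ≤ Nat.card {τ : Perm α | IsConj σ τ} * (Fintype.card α : ℝ) ^ σ.cycleType.card *
          Real.exp 2 ^ u := by gcongr
    _ = _ := mul_right_comm ..

variable {n : ℕ}

theorem div_exp_two_pow_transpositionLength_le_card_isConj (π : Perm (Fin n)) :
    (n / Real.exp 2) ^ transpositionLength π ≤ Nat.card {τ : Perm (Fin n) | IsConj π τ} := by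
  obtain ⟨w, hlen, hswap, hprod⟩ := exists_isSwap_prod_eq π
  have hle : transpositionLength π ≤ w.length := Nat.sInf_le ⟨w, rfl, hswap, hprod⟩
  have hclass := div_exp_two_pow_le_card_isConj π hlen
  rw [Fintype.card_fin] at hclass
  rcases le_total 1 (n / Real.exp 2) with hq | hq
  · exact (pow_le_pow_right₀ hq hle).trans hclass
  · have : Nonempty {τ : Perm (Fin n) | IsConj π τ} := ⟨π, IsConj.refl π⟩
    exact (pow_le_one₀ (by positivity) hq).trans (mod_cast Nat.card_pos)

end ConjugacyClass

section CharacterRatio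

open Equiv
open scoped Nat

variable {n : ℕ} {V : Type*} [AddCommGroup V] [Module ℂ V]
  {ρ : Representation ℂ (Perm (Fin n)) V}

theorem IsBig.sqrt_factorial_lt (hbig : IsBig ρ) :
    √(n ! : ℝ) < Real.exp (√(n : ℝ) * Real.log n) * Module.finrank ℂ V := by
  rw [IsBig, Real.exp_neg] at hbig
  exact (inv_mul_lt_iff₀ (Real.exp_pos _)).mp hbig

variable [FiniteDimensional ℂ V]

theorem div_exp_two_pow_mul_sq_norm_character_le (hρ : ρ.IsIrreducible) (π : Perm (Fin n)) :
    (n / Real.exp 2) ^ transpositionLength π * ‖ρ.character π‖ ^ 2 ≤ n ! := by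
  calc (n / Real.exp 2) ^ transpositionLength π * ‖ρ.character π‖ ^ 2
      ≤ (Nat.card {τ : Perm (Fin n) | IsConj π τ} : ℝ) * ‖ρ.character π‖ ^ 2 := by
        gcongr
        exact div_exp_two_pow_transpositionLength_le_card_isConj π
    _ ≤ (Nat.card (Perm (Fin n)) : ℝ) := card_isConj_mul_sq_norm_character_le hρ π
    _ = n ! := by rw [Nat.card_perm, Nat.card_fin]

theorem norm_character_le (hn : n ≠ 0) (hρ : ρ.IsIrreducible) (π : Perm (Fin n)) :
    ‖ρ.character π‖ ≤
      Real.exp 1 ^ transpositionLength π * (n : ℝ) ^ (-(transpositionLength π : ℝ) / 2) *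
        √(n ! : ℝ) := by
  set t := transpositionLength π
  have hn' : (0 : ℝ) < n := by positivity
  have hrpow : ((n : ℝ) ^ (-(t : ℝ) / 2)) ^ 2 = ((n : ℝ) ^ t)⁻¹ := by
    rw [← Real.rpow_mul_natCast hn'.le, Nat.cast_ofNat, div_mul_cancel₀ _ two_ne_zero,
      Real.rpow_neg hn'.le, Real.rpow_natCast]
  have hexp : Real.exp 2 ^ t = (Real.exp 1 ^ t) ^ 2 := by
    rw [← one_add_one_eq_two, Real.exp_add, ← sq, pow_right_comm]
  refine le_of_sq_le_sq ?_ (by positivity)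
  calc ‖ρ.character π‖ ^ 2 ≤ n ! / (n / Real.exp 2) ^ t := by
        rw [le_div_iff₀' (by positivity)]
        exact div_exp_two_pow_mul_sq_norm_character_le hρ π
    _ = (Real.exp 1 ^ t * (n : ℝ) ^ (-(t : ℝ) / 2) * √(n ! : ℝ)) ^ 2 := by
        rw [mul_pow, mul_pow, hrpow, Real.sq_sqrt (by positivity), div_pow, hexp]
        field_simp

end CharacterRatio

theorem lemma9_general {A : ℝ} (hA : Real.exp 2 ≤ A) {n : ℕ} (hn : n ≠ 0) {V : Type*}
    [AddCommGroup V] [Module ℂ V] [FiniteDimensional ℂ V]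
    {ρ : Representation ℂ (Equiv.Perm (Fin n)) V} (hρ : ρ.IsIrreducible) (hbig : IsBig ρ)
    {π : Equiv.Perm (Fin n)} (hπ : √(n : ℝ) * Real.log n ≤ transpositionLength π) :
    ‖ρ.character π / (Module.finrank ℂ V : ℂ)‖ ≤
      A ^ transpositionLength π * (n : ℝ) ^ (-(transpositionLength π : ℝ) / 2) := by
  set t := transpositionLength π
  set d := Module.finrank ℂ V
  have hd : (0 : ℝ) < d := lt_of_le_of_lt (by positivity) hbig
  have hdim : √(n.factorial : ℝ) ≤ Real.exp 1 ^ t * d := by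
    refine hbig.sqrt_factorial_lt.le.trans ?_
    rw [← Real.exp_nat_mul, mul_one]
    gcongr
  rw [norm_div, Complex.norm_natCast, div_le_iff₀ hd]
  calc ‖ρ.character π‖
      ≤ Real.exp 1 ^ t * (n : ℝ) ^ (-(t : ℝ) / 2) * √(n.factorial : ℝ) :=
        norm_character_le hn hρ π
    _ ≤ Real.exp 1 ^ t * (n : ℝ) ^ (-(t : ℝ) / 2) * (Real.exp 1 ^ t * d) := by gcongr
    _ = Real.exp 2 ^ t * (n : ℝ) ^ (-(t : ℝ) / 2) * d := by
        rw [← one_add_one_eq_two, Real.exp_add]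
        ring
    _ ≤ A ^ t * (n : ℝ) ^ (-(t : ℝ) / 2) * d := by gcongr

theorem lemma9 (A : ℝ) (hA : √2 * Real.exp 2 < A) :
    ∃ N : ℕ, ∀ n : ℕ, N ≤ n →
      ∀ (V : Type*) [AddCommGroup V] [Module ℂ V] [FiniteDimensional ℂ V]
        (ρ : Representation ℂ (Equiv.Perm (Fin n)) V),
        ρ.IsIrreducible → IsBig ρ →
        ∀ π : Equiv.Perm (Fin n),
          √(n : ℝ) * Real.log n < (transpositionLength π : ℝ) →
          ‖ρ.character π / (Module.finrank ℂ V : ℂ)‖ ≤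
            A ^ transpositionLength π * (n : ℝ) ^ (-(transpositionLength π : ℝ) / 2) := by
  have hA' : Real.exp 2 ≤ A :=
    (le_mul_of_one_le_left (Real.exp_pos 2).le (Real.one_le_sqrt.mpr one_le_two)).trans hA.le
  exact ⟨1, fun n hn V _ _ _ ρ hρ hbig π hπ =>
    lemma9_general hA' (Nat.one_le_iff_ne_zero.mp hn) hρ hbig hπ.le⟩
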